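/- Let $X$ be a (real) Banach lattice and let $X^*$ be its norm dual, ordered by $f\le g$ iff $f(x)\le g(x)$ for all $x\ge 0$. The following are equivalent: 1. for every net $(f_\alpha)$ in $X^*$, if $f_\alpha\to 0$ in the weak* topology, then $(f_\alpha)$ un-converges to $0$, that is, $\bigl\| |f_\alpha|\wedge u\bigr\|\to 0$ for every $u\in X^*$ with $u\ge 0$; 2. $X^*$ is atomic, and both $X$ and $X^*$ are order continuous. Here a Banach lattice $E$ is order continuous if $\|x_\alpha\|\to 0$ for every net $(x_\alpha)$ in $E$ with $x_\alpha\downarrow 0$. An atom of $E$ is a vector $0\ne a\ge 0$ such that $\{x\in E : |x|\le c\,a \text{ for some real } c\ge 0\}=\operatorname{span}\{a\}$, and $E$ is atomic if $E$ itself is the smallest band of $E$ containing all atoms of $E$ (a band is a solid linear subspace that contains the supremum of each of its subsets whose supremum exists in $E$). -/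

import Mathlib

open Filter Topology

namespace BanachLattice

universe u

section Notions

/-- Un-convergence of `f` to `x` along a filter: `|f i - x| ⊓ u → 0` in norm for every `u ≥ 0`.
For a net, take the filter `atTop` of its index set. -/
def UnTendsto {ι E : Type*} [NormedAddCommGroup E] [Lattice E]
    (f : ι → E) (l : Filter ι) (x : E) : Prop :=
  ∀ u : E, 0 ≤ u → Tendsto (fun i => ‖|f i - x| ⊓ u‖) l (𝓝 0)

/-- Order continuity of the norm: every net with `x_α ↓ 0` is norm null. Since `x_α ↓ 0` depends
on the net only through its range, nets indexed in the universe of `E` suffice. -/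
def IsOrderContinuous (E : Type u) [NormedAddCommGroup E] [Lattice E] : Prop :=
  ∀ (ι : Type u) [Preorder ι] [IsDirectedOrder ι] [Nonempty ι] (x : ι → E),
    Antitone x → IsGLB (Set.range x) 0 → Tendsto (fun i => ‖x i‖) atTop (𝓝 0)

variable {E : Type*} [AddCommGroup E] [Lattice E] [Module ℝ E]

/-- The (order) ideal generated by a vector `a`. -/
def principalIdeal (a : E) : Set E :=
  {x | ∃ c : ℝ, 0 ≤ c ∧ |x| ≤ c • |a|}

/-- Atoms of a vector lattice: positive nonzero vectors whose principal ideal is their span. -/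
def IsAtomVector (a : E) : Prop :=
  0 ≤ a ∧ a ≠ 0 ∧ principalIdeal a = (Submodule.span ℝ {a} : Set E)

/-- Bands: solid linear subspaces closed under all suprema that exist in `E`. -/
def IsBand (B : Submodule ℝ E) : Prop :=
  (∀ x y : E, |x| ≤ |y| → y ∈ B → x ∈ B) ∧
  ∀ (S : Set E) (x : E), S ⊆ B → IsLUB S x → x ∈ B

/-- The smallest band containing `S`. -/
def bandGenerated (S : Set E) : Submodule ℝ E :=
  sInf {B : Submodule ℝ E | IsBand B ∧ S ⊆ B}

variable (E) in
/-- `E` is atomic if it is the band generated by its atoms. -/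
def IsAtomicLattice : Prop :=
  bandGenerated {a : E | IsAtomVector a} = ⊤

end Notions

/-! ### The dual lattice -/

section Dual

set_option linter.unusedSectionVars false

variable {X : Type*} [NormedAddCommGroup X] [NormedSpace ℝ X] [Lattice X] [HasSolidNorm X]
  [IsOrderedAddMonoid X]

/-- The order of the dual: `f ≤ g` iff `f x ≤ g x` for every `x ≥ 0`. -/
instance dualPartialOrder : PartialOrder (StrongDual ℝ X) where
  le f g := ∀ x : X, 0 ≤ x → f x ≤ g x
  le_refl f x _ := le_rfl
  le_trans f g h hfg hgh x hx := (hfg x hx).trans (hgh x hx)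
  le_antisymm f g hfg hgf := by
    ext x
    have h1 := le_antisymm (hfg x⁺ (posPart_nonneg x)) (hgf x⁺ (posPart_nonneg x))
    have h2 := le_antisymm (hfg x⁻ (negPart_nonneg x)) (hgf x⁻ (negPart_nonneg x))
    rw [← posPart_sub_negPart x, map_sub, map_sub, h1, h2]

/-- The positive part of a functional on the positive cone: `sup {h y | 0 ≤ y ≤ x}`. -/
noncomputable def dualPosAux (h : StrongDual ℝ X) (x : X) : ℝ := sSup (h '' Set.Icc 0 x)

theorem norm_le_of_mem_Icc {x y : X} (hy : y ∈ Set.Icc 0 x) : ‖y‖ ≤ ‖x‖ :=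
  HasSolidNorm.solid (by rw [abs_of_nonneg hy.1, abs_of_nonneg (hy.1.trans hy.2)]; exact hy.2)

theorem dualPosAux_mem_le (h : StrongDual ℝ X) {x y : X} (hy : y ∈ Set.Icc 0 x) :
    h y ≤ ‖h‖ * ‖x‖ :=
  (le_abs_self _).trans ((h.le_opNorm y).trans
    (mul_le_mul_of_nonneg_left (norm_le_of_mem_Icc hy) (norm_nonneg h)))

theorem le_dualPosAux (h : StrongDual ℝ X) {x y : X} (hy : y ∈ Set.Icc 0 x) :
    h y ≤ dualPosAux h x := by
  refine le_csSup ⟨‖h‖ * ‖x‖, ?_⟩ ⟨y, hy, rfl⟩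
  rintro _ ⟨z, hz, rfl⟩
  exact dualPosAux_mem_le h hz

theorem dualPosAux_le (h : StrongDual ℝ X) {x : X} (hx : 0 ≤ x) {c : ℝ}
    (hc : ∀ y ∈ Set.Icc 0 x, h y ≤ c) : dualPosAux h x ≤ c := by
  refine csSup_le ⟨h 0, 0, ⟨le_rfl, hx⟩, rfl⟩ ?_
  rintro _ ⟨z, hz, rfl⟩
  exact hc z hz

theorem dualPosAux_nonneg (h : StrongDual ℝ X) {x : X} (hx : 0 ≤ x) : 0 ≤ dualPosAux h x := by
  simpa using le_dualPosAux h (x := x) (y := 0) ⟨le_rfl, hx⟩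

theorem dualPosAux_add (h : StrongDual ℝ X) {x y : X} (hx : 0 ≤ x) (hy : 0 ≤ y) :
    dualPosAux h (x + y) = dualPosAux h x + dualPosAux h y := by
  apply le_antisymm
  · refine dualPosAux_le h (add_nonneg hx hy) fun z hz => ?_
    have h1 : z ⊓ x ∈ Set.Icc 0 x := ⟨le_inf hz.1 hx, inf_le_right⟩
    have h2 : z - z ⊓ x ∈ Set.Icc 0 y := by
      refine ⟨sub_nonneg.2 inf_le_left, ?_⟩
      rw [sub_le_iff_le_add, add_inf]
      exact le_inf (le_add_of_nonneg_left hy) (by rw [add_comm]; exact hz.2)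
    have h3 := le_dualPosAux h h1
    have h4 := le_dualPosAux h h2
    rw [map_sub] at h4
    linarith
  · rw [← le_sub_iff_add_le]
    refine dualPosAux_le h hx fun a ha => ?_
    rw [le_sub_comm]
    refine dualPosAux_le h hy fun b hb => ?_
    have := le_dualPosAux h (x := x + y) (y := a + b)
      ⟨add_nonneg ha.1 hb.1, add_le_add ha.2 hb.2⟩
    rw [map_add] at this
    linarith

/-- The positive part as an additive map on all of `X`. -/
noncomputable def dualPosHom (h : StrongDual ℝ X) : X →+ ℝ where
  toFun x := dualPosAux h x⁺ - dualPosAux h x⁻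
  map_zero' := by simp
  map_add' x y := by
    have e : (x + y)⁺ + (x⁻ + y⁻) = (x⁺ + y⁺) + (x + y)⁻ := by
      have h1 := posPart_sub_negPart (x + y)
      have h2 := posPart_sub_negPart x
      have h3 := posPart_sub_negPart y
      rw [← sub_eq_zero]
      have : (x + y)⁺ + (x⁻ + y⁻) - ((x⁺ + y⁺) + (x + y)⁻)
          = ((x + y)⁺ - (x + y)⁻) - (x⁺ - x⁻) - (y⁺ - y⁻) := by abel
      rw [this, h1, h2, h3]; abel
    have e' := congrArg (dualPosAux h) e
    rw [dualPosAux_add h (posPart_nonneg _) (add_nonneg (negPart_nonneg _) (negPart_nonneg _)),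
      dualPosAux_add h (negPart_nonneg _) (negPart_nonneg _),
      dualPosAux_add h (add_nonneg (posPart_nonneg _) (posPart_nonneg _)) (negPart_nonneg _),
      dualPosAux_add h (posPart_nonneg _) (posPart_nonneg _)] at e'
    linarith

theorem dualPosHom_bound (h : StrongDual ℝ X) (x : X) : ‖dualPosHom h x‖ ≤ ‖h‖ * ‖x‖ := by
  have key : ∀ z : X, 0 ≤ z → z ≤ |x| → dualPosAux h z ≤ ‖h‖ * ‖x‖ := fun z hz hzx =>
    dualPosAux_le h hz fun y hy => by
      have := dualPosAux_mem_le h (x := |x|) (y := y) ⟨hy.1, hy.2.trans hzx⟩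
      rwa [norm_abs_eq_norm] at this
  have h1 := key x⁺ (posPart_nonneg x) (sup_le (le_abs_self x) (abs_nonneg x))
  have h2 := key x⁻ (negPart_nonneg x) (sup_le (neg_le_abs x) (abs_nonneg x))
  have h3 := dualPosAux_nonneg h (posPart_nonneg x)
  have h4 := dualPosAux_nonneg h (negPart_nonneg x)
  change |dualPosAux h x⁺ - dualPosAux h x⁻| ≤ _
  rw [abs_le]
  constructor <;> linarith

/-- The positive part `h⁺` of a continuous functional (Riesz-Kantorovich formula). -/
noncomputable def dualPos (h : StrongDual ℝ X) : StrongDual ℝ X :=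
  (dualPosHom h).toRealLinearMap
    (AddMonoidHomClass.continuous_of_bound (dualPosHom h) ‖h‖ (dualPosHom_bound h))

theorem dualPos_apply (h : StrongDual ℝ X) {x : X} (hx : 0 ≤ x) :
    dualPos h x = sSup (h '' Set.Icc 0 x) := by
  change dualPosAux h x⁺ - dualPosAux h x⁻ = dualPosAux h x
  have : dualPosAux h 0 = 0 := by simp [dualPosAux]
  rw [posPart_of_nonneg hx, negPart_of_nonneg hx, this, sub_zero]

/-- The dual of a Banach lattice is a lattice. -/
noncomputable instance dualLattice : Lattice (StrongDual ℝ X) where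
  toPartialOrder := dualPartialOrder
  sup f g := g + dualPos (f - g)
  inf f g := f - dualPos (f - g)
  le_sup_left f g x hx := by
    have := le_dualPosAux (f - g) (x := x) (y := x) ⟨hx, le_rfl⟩
    change f x ≤ g x + dualPos (f - g) x
    rw [dualPos_apply _ hx]
    change f x - g x ≤ _ at this
    rw [dualPosAux] at this
    linarith
  le_sup_right f g x hx := by
    have := dualPosAux_nonneg (f - g) hx
    change g x ≤ g x + dualPos (f - g) x
    rw [dualPos_apply _ hx]
    rw [dualPosAux] at this
    linarith
  sup_le f g k hf hg x hx := by
    change g x + dualPos (f - g) x ≤ k x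
    rw [dualPos_apply _ hx, ← le_sub_iff_add_le']
    refine dualPosAux_le _ hx fun y hy => ?_
    have h1 := hf y hy.1
    have h2 := hg (x - y) (sub_nonneg.2 hy.2)
    rw [map_sub, map_sub] at h2
    change f y - g y ≤ _
    linarith
  inf_le_left f g x hx := by
    have := dualPosAux_nonneg (f - g) hx
    change f x - dualPos (f - g) x ≤ f x
    rw [dualPos_apply _ hx]
    rw [dualPosAux] at this
    linarith
  inf_le_right f g x hx := by
    have := le_dualPosAux (f - g) (x := x) (y := x) ⟨hx, le_rfl⟩
    change f x - dualPos (f - g) x ≤ g x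
    rw [dualPos_apply _ hx]
    change f x - g x ≤ _ at this
    rw [dualPosAux] at this
    linarith
  le_inf k f g hf hg x hx := by
    change k x ≤ f x - dualPos (f - g) x
    rw [dualPos_apply _ hx, le_sub_comm]
    refine dualPosAux_le _ hx fun y hy => ?_
    have h1 := hg y hy.1
    have h2 := hf (x - y) (sub_nonneg.2 hy.2)
    rw [map_sub, map_sub] at h2
    change f y - g y ≤ _
    linarith

end Dual

end BanachLattice

namespace BanachLattice

universe u

/-! ### The dual as a normed vector lattice -/

section DualNormedLattice

set_option linter.unusedSectionVars false

variable {X : Type*} [NormedAddCommGroup X] [NormedSpace ℝ X] [Lattice X] [HasSolidNorm X]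
  [IsOrderedAddMonoid X]

/-! From un-convergence to structure: on an order interval `[0, u]` of the dual, un-convergence is
norm convergence, so Banach–Alaoglu makes `[0, u]` norm compact (`isCompact_Icc`). A decreasing
positive sequence then has vanishing gaps, which makes the dual order continuous. For `X`, norming
functionals of the gaps of a decreasing sequence are compared with their weak* limit. For atoms,
suppose there is none below `u ≠ 0`. An extreme-point argument of Lyapunov type gives components `v`
of `u` with `v x = u x / 2` at finitely many prescribed `x`; by compactness some component equals `u
/ 2`, so `u = 0`.

Conversely, order continuity of `X` gives each atom `a` of the dual a carrier atom `e` of `X`, with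
`a e = 1`. Evaluation at `e` is then the coordinate along `a`, and `|f| e = |f e|`. If `P_F`
projects onto finitely many norm-one atoms, `u - P_F u` decreases to zero by atomicity, hence in
norm. The estimate `|f| ⊓ u ≤ P_F |f| + (u - P_F u)` finishes the proof: for fixed `F` the first
term depends on finitely many numbers `|f e|`, which tend to zero along a weak* null net. -/

theorem dual_le_iff {f g : StrongDual ℝ X} : f ≤ g ↔ ∀ x : X, 0 ≤ x → f x ≤ g x := Iff.rfl

instance dualIsOrderedAddMonoid : IsOrderedAddMonoid (StrongDual ℝ X) where
  add_le_add_left f g h k x hx := by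
    simpa using h x hx

instance dualIsOrderedModule : IsOrderedModule ℝ (StrongDual ℝ X) where
  smul_le_smul_of_nonneg_left c hc f g h x hx := by
    simpa using mul_le_mul_of_nonneg_left (h x hx) hc
  smul_le_smul_of_nonneg_right f hf c d h x hx := by
    simpa using mul_le_mul_of_nonneg_right h (hf x hx)

theorem dual_monotone {f : StrongDual ℝ X} (hf : 0 ≤ f) {x y : X} (h : x ≤ y) : f x ≤ f y := by
  have := hf (y - x) (sub_nonneg.2 h)
  rw [map_sub] at this
  simpa using this

theorem dual_posPart_apply (f : StrongDual ℝ X) (x : X) : f⁺ x = dualPos f x := by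
  have : f⁺ = 0 + dualPos (f - 0) := rfl
  rw [this, zero_add, sub_zero]

theorem dual_posPart_apply_le (f : StrongDual ℝ X) {x : X} (hx : 0 ≤ x) {c : ℝ}
    (hc : ∀ y, 0 ≤ y → y ≤ x → f y ≤ c) : f⁺ x ≤ c := by
  rw [dual_posPart_apply, dualPos_apply _ hx]
  exact dualPosAux_le f hx fun y hy => hc y hy.1 hy.2

/-- Riesz–Kantorovich for `|f| = f⁺ + (-f)⁺`: if `y` and `z` lie in `[0, x]`, then `|y - z| ≤ x`. -/
theorem dual_abs_apply_le (f : StrongDual ℝ X) {x : X} (hx : 0 ≤ x) {c : ℝ}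
    (hc : ∀ y, |y| ≤ x → f y ≤ c) : |f| x ≤ c := by
  have h : |f| x = f⁺ x + (-f)⁺ x := by
    rw [← posPart_add_negPart f, posPart_neg]; rfl
  rw [h, ← le_sub_iff_add_le]
  refine dual_posPart_apply_le f hx fun y hy hyx => ?_
  rw [le_sub_comm]
  refine dual_posPart_apply_le (-f) hx fun z hz hzx => ?_
  have h1 := hc (y - z) (abs_le'.2
    ⟨(sub_le_self _ hz).trans hyx, by rw [neg_sub]; exact (sub_le_self _ hy).trans hzx⟩)
  rw [map_sub] at h1
  rw [neg_apply]
  linarith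

theorem abs_apply_le_abs_apply_abs (f : StrongDual ℝ X) (x : X) : |f x| ≤ |f| |x| := by
  have key : ∀ g : StrongDual ℝ X, 0 ≤ g → ∀ y : X, |g y| ≤ g |y| := fun g hg y => by
    rw [abs_le']
    refine ⟨dual_monotone hg (le_abs_self y), ?_⟩
    rw [← map_neg]
    exact dual_monotone hg (neg_le_abs y)
  have h1 := key f⁺ (posPart_nonneg f) x
  have h2 := key f⁻ (negPart_nonneg f) x
  have h3 : f x = f⁺ x - f⁻ x := by
    conv_lhs => rw [← posPart_sub_negPart f]
    rfl
  have h4 : |f| |x| = f⁺ |x| + f⁻ |x| := by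
    rw [← posPart_add_negPart f]; rfl
  rw [h3, h4]
  exact (abs_sub _ _).trans (add_le_add h1 h2)

theorem dual_norm_abs_le (f : StrongDual ℝ X) : ‖|f|‖ ≤ ‖f‖ := by
  refine ContinuousLinearMap.opNorm_le_bound _ (norm_nonneg _) fun x => ?_
  have h := abs_apply_le_abs_apply_abs |f| x
  rw [abs_abs] at h
  refine h.trans (dual_abs_apply_le f (abs_nonneg x) fun y hy => ?_)
  exact (le_abs_self _).trans ((f.le_opNorm y).trans
    (mul_le_mul_of_nonneg_left (HasSolidNorm.solid hy) (norm_nonneg f)))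

instance dualHasSolidNorm : HasSolidNorm (StrongDual ℝ X) where
  solid f g h := by
    refine le_trans ?_ (dual_norm_abs_le g)
    refine ContinuousLinearMap.opNorm_le_bound _ (norm_nonneg _) fun x => ?_
    calc ‖f x‖ ≤ |f| |x| := abs_apply_le_abs_apply_abs f x
      _ ≤ |g| |x| := h |x| (abs_nonneg x)
      _ ≤ ‖|g|‖ * ‖|x|‖ := (le_abs_self _).trans (|g|.le_opNorm _)
      _ = ‖|g|‖ * ‖x‖ := by rw [norm_abs_eq_norm x]

/-- A positive functional attains its value at `x⁺` through a smaller positive functional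
evaluated at `x`. -/
theorem exists_le_apply_eq_apply_posPart [IsOrderedModule ℝ X] {a : StrongDual ℝ X} (ha : 0 ≤ a)
    (x : X) : ∃ g : StrongDual ℝ X, 0 ≤ g ∧ g ≤ a ∧ g x = a x⁺ := by
  have hN_hom : ∀ c : ℝ, 0 < c → ∀ y : X, a (c • y)⁺ = c * a y⁺ := fun c hc y => by
    have : (c • y)⁺ = c • y⁺ := by
      refine le_antisymm (sup_le (smul_le_smul_of_nonneg_left (le_posPart y) hc.le)
        (smul_nonneg hc.le (posPart_nonneg y))) ?_
      rw [← le_inv_smul_iff_of_pos hc]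
      refine sup_le ?_ (smul_nonneg (inv_nonneg.2 hc.le) (posPart_nonneg _))
      rw [le_inv_smul_iff_of_pos hc]
      exact le_posPart _
    rw [this, map_smul, smul_eq_mul]
  have hN_add : ∀ y z : X, a (y + z)⁺ ≤ a y⁺ + a z⁺ := fun y z => by
    rw [← map_add]
    exact dual_monotone ha (sup_le (add_le_add (le_posPart y) (le_posPart z))
      (add_nonneg (posPart_nonneg y) (posPart_nonneg z)))
  -- Hahn–Banach on the line through `x`, dominated by the sublinear functional `y ↦ a y⁺`.
  -- Domination at `-y` and `y`, for `y ≥ 0`, gives `0 ≤ g ≤ a`.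
  obtain ⟨g, hgx, hga⟩ : ∃ g : X →ₗ[ℝ] ℝ, g x = a x⁺ ∧ ∀ y, g y ≤ a y⁺ := by
    rcases eq_or_ne x 0 with rfl | hx
    · exact ⟨0, by simp, fun y => ha _ (posPart_nonneg y)⟩
    · obtain ⟨g, h1, h2⟩ := exists_extension_of_le_sublinear
        (LinearPMap.mkSpanSingleton x (a x⁺) hx) (fun y => a y⁺) hN_hom hN_add (by
          rintro ⟨y, hy⟩
          obtain ⟨c, rfl⟩ := Submodule.mem_span_singleton.1 hy
          refine (LinearPMap.mkSpanSingleton'_apply x (a x⁺) _ c hy).le.trans ?_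
          rw [RingHom.id_apply, smul_eq_mul]
          rcases lt_or_ge 0 c with hc | hc
          · exact (hN_hom c hc x).ge
          · exact (mul_nonpos_of_nonpos_of_nonneg hc (ha _ (posPart_nonneg x))).trans
              (ha _ (posPart_nonneg _)))
      refine ⟨g, ?_, h2⟩
      have := h1 ⟨x, Submodule.mem_span_singleton_self x⟩
      rw [this]
      exact LinearPMap.mkSpanSingleton_apply ℝ ℝ hx _
  have hbound : ∀ y, ‖g y‖ ≤ ‖a‖ * ‖y‖ := fun y => by
    have key : ∀ z : X, ‖z‖ = ‖y‖ → g z ≤ ‖a‖ * ‖y‖ := fun z hz => by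
      refine (hga z).trans ((le_abs_self _).trans ((a.le_opNorm _).trans
        (mul_le_mul_of_nonneg_left ?_ (norm_nonneg a))))
      rw [← hz, ← norm_abs_eq_norm z]
      exact norm_le_of_mem_Icc ⟨posPart_nonneg z, sup_le (le_abs_self z) (abs_nonneg z)⟩
    rw [Real.norm_eq_abs, abs_le']
    exact ⟨key y rfl, by rw [← map_neg]; exact key (-y) (norm_neg y)⟩
  refine ⟨g.mkContinuous ‖a‖ hbound, fun y hy => ?_, fun y hy => ?_, hgx⟩
  · have := hga (-y)
    rw [map_neg, posPart_of_nonpos (neg_nonpos.2 hy), map_zero] at this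
    simpa using this
  · have := hga y
    rwa [posPart_of_nonneg hy] at this

end DualNormedLattice

/-! ### Order continuity of the norm -/

section OrderContinuity

variable {E : Type u} [NormedAddCommGroup E] [Lattice E] [HasSolidNorm E] [IsOrderedAddMonoid E]

theorem norm_le_norm_of_nonneg_of_le {x y : E} (hx : 0 ≤ x) (h : x ≤ y) : ‖x‖ ≤ ‖y‖ :=
  HasSolidNorm.solid (by rwa [abs_of_nonneg hx, abs_of_nonneg (hx.trans h)])

theorem exists_tendsto_isGLB_of_antitone [CompleteSpace E] {ι : Type*} [Preorder ι]
    [IsDirectedOrder ι] [Nonempty ι] {x : ι → E} (hx : Antitone x)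
    (h : ∀ ε > 0, ∃ i, ∀ j, i ≤ j → ‖x i - x j‖ < ε) :
    ∃ l, Tendsto x atTop (𝓝 l) ∧ IsGLB (Set.range x) l := by
  have hc : Cauchy (map x atTop) := by
    rw [Metric.cauchy_iff]
    refine ⟨inferInstance, fun ε hε => ?_⟩
    obtain ⟨i, hi⟩ := h (ε / 2) (half_pos hε)
    refine ⟨x '' Set.Ici i, image_mem_map (Ici_mem_atTop i), ?_⟩
    rintro _ ⟨j, hj, rfl⟩ _ ⟨k, hk, rfl⟩
    have h1 := hi j hj
    have h2 := hi k hk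
    rw [← dist_eq_norm] at h1 h2
    have := dist_triangle_left (x j) (x k) (x i)
    linarith
  obtain ⟨l, hl⟩ := CompleteSpace.complete hc
  refine ⟨l, hl, ?_⟩
  exact isGLB_of_tendsto_atTop hx hl

/-- A decreasing net that is not Cauchy contains a decreasing sequence with gaps bounded below; a
Cauchy one converges to its infimum. -/
theorem isOrderContinuous_of_antitone_seq [CompleteSpace E]
    (h : ∀ x : ℕ → E, Antitone x → (∀ n, 0 ≤ x n) → ∀ ε > 0, ∃ n, ‖x n - x (n + 1)‖ < ε) :
    IsOrderContinuous E := by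
  intro ι _ _ _ x hx hglb
  obtain ⟨l, hl, hl'⟩ := exists_tendsto_isGLB_of_antitone hx (by
    by_contra! hcon
    obtain ⟨ε, hε, hcon⟩ := hcon
    choose nxt hnxt hgap using hcon
    have i₀ : ι := Classical.arbitrary ι
    obtain ⟨n, hn⟩ := h (fun n => x (nxt^[n] i₀))
      (antitone_nat_of_succ_le fun n => hx (by
        rw [Function.iterate_succ_apply']; exact hnxt _))
      (fun n => hglb.1 ⟨_, rfl⟩) ε hε
    simp only [Function.iterate_succ_apply'] at hn
    exact (hgap _).not_gt hn)
  have : l = 0 := hl'.unique hglb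
  subst this
  simpa using hl.norm

/-- The existence of the infimum is not presupposed. The differences between members and lower
bounds of `S` decrease to zero, so order continuity makes `S`, as a decreasing net, norm Cauchy. -/
theorem IsOrderContinuous.exists_isGLB_mem_closure [NormedSpace ℝ E] [IsOrderedModule ℝ E]
    [CompleteSpace E] (hE : IsOrderContinuous E)
    {S : Set E} (hS : S.Nonempty) (hdir : ∀ x ∈ S, ∀ y ∈ S, ∃ z ∈ S, z ≤ x ∧ z ≤ y)
    (hbdd : BddBelow S) : ∃ s, IsGLB S s ∧ s ∈ closure S := by
  obtain ⟨s₀, hs₀⟩ := hS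
  obtain ⟨b, hb⟩ := hbdd
  have : Nonempty (OrderDual S) := ⟨OrderDual.toDual ⟨s₀, hs₀⟩⟩
  have : Nonempty (lowerBounds S) := ⟨⟨b, hb⟩⟩
  have : IsDirectedOrder (OrderDual S) := ⟨fun p q => by
    obtain ⟨z, hz, h1, h2⟩ := hdir _ p.ofDual.2 _ q.ofDual.2
    exact ⟨OrderDual.toDual ⟨z, hz⟩, h1, h2⟩⟩
  have : IsDirectedOrder (lowerBounds S) := ⟨fun p q =>
    ⟨⟨p.1 ⊔ q.1, fun s hs => sup_le (p.2 hs) (q.2 hs)⟩,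
      (le_sup_left : p.1 ≤ p.1 ⊔ q.1), (le_sup_right : q.1 ≤ p.1 ⊔ q.1)⟩⟩
  have : IsDirectedOrder (OrderDual S × lowerBounds S) := ⟨fun p q => by
    obtain ⟨a, ha, ha'⟩ := exists_ge_ge p.1 q.1
    obtain ⟨b, hb, hb'⟩ := exists_ge_ge p.2 q.2
    exact ⟨(a, b), ⟨ha, hb⟩, ⟨ha', hb'⟩⟩⟩
  have hanti : Antitone fun p : OrderDual S × lowerBounds S => (p.1.ofDual : E) - p.2 :=
    fun p q hpq => sub_le_sub (show (q.1.ofDual : E) ≤ p.1.ofDual from hpq.1) hpq.2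
  have hglb : IsGLB (Set.range fun p : OrderDual S × lowerBounds S =>
      (p.1.ofDual : E) - p.2) 0 := by
    refine ⟨?_, fun v hv => ?_⟩
    · rintro _ ⟨p, rfl⟩
      exact sub_nonneg.2 (p.2.2 p.1.ofDual.2)
    · have hv' : ∀ s ∈ S, ∀ z ∈ lowerBounds S, v⁺ ≤ s - z := fun s hs z hz =>
        sup_le (hv ⟨(OrderDual.toDual ⟨s, hs⟩, ⟨z, hz⟩), rfl⟩) (sub_nonneg.2 (hz hs))
      -- `v⁺` is below every difference, so it can be added repeatedly to a lower bound; the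
      -- Archimedean bound on norms then forces `v⁺ = 0`.
      have hn : ∀ n : ℕ, b + n • v⁺ ∈ lowerBounds S := fun n => by
        induction n with
        | zero => simpa using hb
        | succ n ih =>
          intro s hs
          have := hv' s hs _ ih
          rw [succ_nsmul, ← add_assoc]
          rwa [le_sub_iff_add_le'] at this
      have hle : ∀ n : ℕ, n * ‖v⁺‖ ≤ ‖s₀ - b‖ := fun n => by
        have h1 : (n : ℝ) • v⁺ ≤ s₀ - b := by
          rw [Nat.cast_smul_eq_nsmul, le_sub_iff_add_le']
          exact hn n hs₀
        have h2 := norm_le_norm_of_nonneg_of_le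
          (smul_nonneg (Nat.cast_nonneg n) (posPart_nonneg v)) h1
        rwa [norm_smul, Real.norm_natCast] at h2
      have h0 : ‖v⁺‖ = 0 := by
        by_contra hne
        have hpos := lt_of_le_of_ne (norm_nonneg v⁺) (Ne.symm hne)
        obtain ⟨n, hn⟩ := exists_nat_gt (‖s₀ - b‖ / ‖v⁺‖)
        rw [div_lt_iff₀ hpos] at hn
        exact (hle n).not_gt hn
      exact (le_posPart v).trans (norm_eq_zero.1 h0).le
  have hlim := hE _ _ hanti hglb
  obtain ⟨l, hl, hl'⟩ := exists_tendsto_isGLB_of_antitone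
    (x := fun p : OrderDual S => (p.ofDual : E)) (fun p q hpq => hpq) (by
      intro ε hε
      obtain ⟨⟨p, z⟩, hp⟩ := ((hlim.eventually (gt_mem_nhds hε))).exists
      refine ⟨p, fun q hq => lt_of_le_of_lt ?_ hp⟩
      exact norm_le_norm_of_nonneg_of_le (sub_nonneg.2 hq) (sub_le_sub_left (z.2 q.ofDual.2) _))
  refine ⟨l, ?_, mem_closure_of_tendsto hl (Eventually.of_forall fun p => p.ofDual.2)⟩
  convert hl'
  ext s
  exact ⟨fun hs => ⟨OrderDual.toDual ⟨s, hs⟩, rfl⟩, fun ⟨p, hp⟩ => hp ▸ p.ofDual.2⟩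

end OrderContinuity

/-! ### Atoms in finite-dimensional principal ideals -/

section Atoms

set_option linter.unusedSectionVars false

variable {E : Type*} [NormedAddCommGroup E] [NormedSpace ℝ E] [Lattice E] [HasSolidNorm E]
  [IsOrderedAddMonoid E] [IsOrderedModule ℝ E]

theorem abs_smul_le_smul_abs (c : ℝ) (x : E) : |c • x| ≤ |c| • |x| := by
  have h := smul_le_smul_of_nonneg_left (le_abs_self x) (abs_nonneg c)
  have h' := smul_le_smul_of_nonneg_left (neg_le_abs x) (abs_nonneg c)
  rw [smul_neg] at h'
  rcases abs_cases c with ⟨hc, _⟩ | ⟨hc, _⟩ <;> rw [hc] at h h' ⊢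
  · exact abs_le'.2 ⟨h, h'⟩
  · refine abs_le'.2 ⟨?_, ?_⟩
    · rwa [neg_smul c x, neg_neg] at h'
    · rwa [neg_smul c x] at h

/-- The principal ideal of a vector, as a linear subspace. -/
def principalIdealSubmodule (a : E) : Submodule ℝ E where
  carrier := principalIdeal a
  zero_mem' := ⟨0, le_rfl, by simp⟩
  add_mem' := by
    rintro x y ⟨c, hc, hx⟩ ⟨d, hd, hy⟩
    exact ⟨c + d, add_nonneg hc hd, by
      rw [add_smul]; exact (abs_add_le x y).trans (add_le_add hx hy)⟩
  smul_mem' := by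
    rintro r x ⟨c, hc, hx⟩
    refine ⟨|r| * c, mul_nonneg (abs_nonneg r) hc, (abs_smul_le_smul_abs r x).trans ?_⟩
    rw [mul_smul]
    exact smul_le_smul_of_nonneg_left hx (abs_nonneg r)

theorem principalIdealSubmodule_mono {a b : E} (h : a ∈ principalIdealSubmodule b) :
    principalIdealSubmodule a ≤ principalIdealSubmodule b := by
  rintro x ⟨c, hc, hx⟩
  obtain ⟨d, hd, ha⟩ := h
  refine ⟨c * d, mul_nonneg hc hd, hx.trans ?_⟩
  rw [mul_smul]
  exact smul_le_smul_of_nonneg_left ha hc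

theorem mem_principalIdealSubmodule_of_abs_le {a x y : E} (hy : y ∈ principalIdealSubmodule a)
    (h : |x| ≤ |y|) : x ∈ principalIdealSubmodule a := by
  obtain ⟨c, hc, hy⟩ := hy
  exact ⟨c, hc, h.trans hy⟩

theorem self_mem_principalIdealSubmodule (a : E) : a ∈ principalIdealSubmodule a :=
  ⟨1, zero_le_one, by rw [one_smul]⟩

/-- A vector of a principal ideal that is no multiple of the generator can be separated from it. -/
theorem exists_posPart_ne_zero_negPart_ne_zero {w z : E} (hw : 0 ≤ w)
    (hz : z ∈ principalIdealSubmodule w) (hzw : z ∉ Submodule.span ℝ {w}) :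
    ∃ t : ℝ, (z - t • w)⁺ ≠ 0 ∧ (z - t • w)⁻ ≠ 0 := by
  obtain ⟨c, hc, hz⟩ := hz
  rw [abs_of_nonneg hw] at hz
  by_contra! hcon
  have hcl1 : IsClosed {t : ℝ | z ≤ t • w} :=
    isClosed_le continuous_const (continuous_id.smul continuous_const)
  have hcl2 : IsClosed {t : ℝ | t • w ≤ z} :=
    isClosed_le (continuous_id.smul continuous_const) continuous_const
  -- If no `t` separates, the closed sets `z ≤ t • w` and `t • w ≤ z` cover the line; by
  -- connectedness they meet, and `z` is a multiple of `w`.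
  obtain ⟨t, -, h1, h2⟩ := isPreconnected_closed_iff.1 (isPreconnected_univ (α := ℝ)) _ _ hcl1 hcl2
    (fun t _ => by
      by_cases h : (z - t • w)⁺ = 0
      · exact Or.inl (sub_nonpos.1 (posPart_eq_zero.1 h))
      · exact Or.inr (sub_nonneg.1 (negPart_eq_zero.1 (hcon t h))))
    ⟨c, trivial, (le_abs_self z).trans hz⟩
    ⟨-c, trivial, by
      change (-c) • w ≤ z
      rw [neg_smul, neg_le]
      exact (neg_le_abs z).trans hz⟩
  exact hzw (Submodule.mem_span_singleton.2 ⟨t, le_antisymm h2 h1⟩)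

/-- A nonzero finite-dimensional principal ideal contains an atom. -/
theorem exists_isAtomVector_of_finiteDimensional {w : E} (hw : 0 ≤ w) (hw0 : w ≠ 0)
    (hfin : FiniteDimensional ℝ (principalIdealSubmodule w)) :
    ∃ a ∈ principalIdealSubmodule w, IsAtomVector a := by
  induction hn : Module.finrank ℝ (principalIdealSubmodule w) using Nat.strong_induction_on
    generalizing w with
  | _ n ih =>
  by_cases hatom : IsAtomVector w
  · exact ⟨w, self_mem_principalIdealSubmodule w, hatom⟩
  obtain ⟨z, hz, hzw⟩ : ∃ z ∈ principalIdealSubmodule w, z ∉ Submodule.span ℝ {w} := by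
    by_contra! hcon
    refine hatom ⟨hw, hw0, Set.Subset.antisymm hcon ?_⟩
    intro x hx
    obtain ⟨c, rfl⟩ := Submodule.mem_span_singleton.1 hx
    exact (principalIdealSubmodule w).smul_mem c (self_mem_principalIdealSubmodule w)
  obtain ⟨t, h1, h2⟩ := exists_posPart_ne_zero_negPart_ne_zero hw hz hzw
  set y := z - t • w with hy
  have hyw : y ∈ principalIdealSubmodule w :=
    Submodule.sub_mem _ hz (Submodule.smul_mem _ _ (self_mem_principalIdealSubmodule w))
  have hpos : y⁺ ∈ principalIdealSubmodule w := mem_principalIdealSubmodule_of_abs_le hyw (by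
    rw [abs_of_nonneg (posPart_nonneg y)]; exact sup_le (le_abs_self y) (abs_nonneg y))
  have hneg : y⁻ ∈ principalIdealSubmodule w := mem_principalIdealSubmodule_of_abs_le hyw (by
    rw [abs_of_nonneg (negPart_nonneg y)]; exact sup_le (neg_le_abs y) (abs_nonneg y))
  -- Disjointness of `y⁺` and `y⁻` makes the ideal of `y⁺` a proper subspace, so the dimension
  -- drops.
  have hnot : y⁻ ∉ principalIdealSubmodule y⁺ := by
    rintro ⟨c, hc, hle⟩
    rw [abs_of_nonneg (negPart_nonneg y), abs_of_nonneg (posPart_nonneg y)] at hle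
    have hc1 : 0 < c + 1 := by linarith
    have h3 : (c + 1)⁻¹ • y⁻ ≤ y⁺ := by
      rw [inv_smul_le_iff_of_pos hc1]
      exact hle.trans (smul_le_smul_of_nonneg_right (by linarith) (posPart_nonneg y))
    have h4 : (c + 1)⁻¹ • y⁻ ≤ y⁻ := by
      rw [inv_smul_le_iff_of_pos hc1]
      conv_lhs => rw [← one_smul ℝ y⁻]
      exact smul_le_smul_of_nonneg_right (by linarith) (negPart_nonneg y)
    have h5 := le_inf h3 h4
    rw [posPart_inf_negPart_eq_zero, inv_smul_le_iff_of_pos hc1, smul_zero] at h5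
    exact h2 (le_antisymm h5 (negPart_nonneg y))
  have hlt : principalIdealSubmodule y⁺ < principalIdealSubmodule w :=
    lt_of_le_of_ne (principalIdealSubmodule_mono hpos) fun h => hnot (h ▸ hneg)
  obtain ⟨a, ha, ha'⟩ := ih _ (hn ▸ Submodule.finrank_lt_finrank_of_lt hlt) (posPart_nonneg y) h1
    (Submodule.finiteDimensional_of_le hlt.le) rfl
  exact ⟨a, hlt.le ha, ha'⟩

end Atoms

/-! ### Weak* null nets and filters on `ℕ` -/

/-- The index set of the canonical net of a filter on `ℕ`, in an arbitrary universe. -/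
structure FilterNetIndex (l : Filter ℕ) : Type u where
  /-- A member of the filter. -/
  set : Set ℕ
  /-- A point of that member. -/
  point : ℕ
  set_mem : set ∈ l
  point_mem : point ∈ set

instance (l : Filter ℕ) : Preorder (FilterNetIndex l) where
  le p q := q.set ⊆ p.set
  le_refl p := subset_rfl
  le_trans p q r hpq hqr := hqr.trans hpq

section WeakStarNull

set_option linter.unusedSectionVars false

variable {X : Type*} [NormedAddCommGroup X] [NormedSpace ℝ X] [Lattice X] [HasSolidNorm X]
  [IsOrderedAddMonoid X]

variable (X) in
/-- Functionals indexed by `ℕ` that are weak* null along a filter are un-null along it. -/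
def WeakStarNullImpliesUnNull : Prop :=
  ∀ (l : Filter ℕ) [l.NeBot] (f : ℕ → StrongDual ℝ X),
    (∀ x, Tendsto (fun n => f n x) l (𝓝 0)) → UnTendsto f l 0

theorem tendsto_toWeakDual_zero_iff {ι : Type*} {l : Filter ι} {f : ι → StrongDual ℝ X} :
    Tendsto (fun i => StrongDual.toWeakDual (f i)) l (𝓝 0) ↔
      ∀ x, Tendsto (fun i => f i x) l (𝓝 0) := by
  rw [tendsto_iff_forall_eval_tendsto_topDualPairing]
  rfl

/-- It suffices to know the implication for nets indexed in a single universe. -/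
theorem weakStarNullImpliesUnNull_of_nets
    (h : ∀ (ι : Type u) [Preorder ι] [IsDirectedOrder ι] [Nonempty ι] (f : ι → StrongDual ℝ X),
      Tendsto (fun i => StrongDual.toWeakDual (f i)) atTop (𝓝 0) → UnTendsto f atTop 0) :
    WeakStarNullImpliesUnNull X := by
  intro l _ f hf v hv
  have hmk : ∀ s ∈ l, ∃ p : FilterNetIndex.{u} l, p.set = s := fun s hs => by
    obtain ⟨n, hn⟩ := nonempty_of_mem hs
    exact ⟨⟨s, n, hs, hn⟩, rfl⟩
  have : Nonempty (FilterNetIndex.{u} l) := let ⟨p, _⟩ := hmk _ univ_mem; ⟨p⟩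
  have : IsDirectedOrder (FilterNetIndex.{u} l) := ⟨fun p q => by
    obtain ⟨r, hr⟩ := hmk _ (inter_mem p.set_mem q.set_mem)
    exact ⟨r, show r.set ⊆ p.set from hr ▸ Set.inter_subset_left,
      show r.set ⊆ q.set from hr ▸ Set.inter_subset_right⟩⟩
  have hmap : map (FilterNetIndex.point : FilterNetIndex.{u} l → ℕ) atTop = l := by
    refine le_antisymm (fun s hs => ?_) (fun s hs => ?_)
    · obtain ⟨p, hp⟩ := hmk s hs
      refine mem_map.2 (mem_of_superset (Ici_mem_atTop p) fun q hq => ?_)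
      have : q.set ⊆ p.set := hq
      exact hp ▸ this q.point_mem
    · obtain ⟨p, hp⟩ := mem_atTop_sets.1 (mem_map.1 hs)
      exact mem_of_superset p.set_mem fun n hn => hp ⟨p.set, n, p.set_mem, hn⟩ (le_refl p.set)
  have key := h _ (f ∘ FilterNetIndex.point) (tendsto_toWeakDual_zero_iff.2 fun x => by
    have := hf x
    rwa [← hmap, tendsto_map'_iff] at this) v hv
  rw [← hmap, tendsto_map'_iff]
  exact key

/-- Banach–Alaoglu, in ultrafilter form. -/
theorem exists_tendsto_apply_of_norm_le (U : Ultrafilter ℕ) (f : ℕ → StrongDual ℝ X) {C : ℝ}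
    (hf : ∀ n, ‖f n‖ ≤ C) : ∃ g : StrongDual ℝ X, ∀ x, Tendsto (fun n => f n x) U (𝓝 (g x)) := by
  obtain ⟨g, -, hg⟩ := (WeakDual.isCompact_closedBall (𝕜 := ℝ)
    (0 : StrongDual ℝ X) C).ultrafilter_le_nhds
    (U.map fun n => StrongDual.toWeakDual (f n)) (le_principal_iff.2
      (mem_map.2 (univ_mem' fun n => by simpa using hf n)))
  refine ⟨WeakDual.toStrongDual g, fun x => ?_⟩
  have hg' : Tendsto (fun n => StrongDual.toWeakDual (f n)) U (𝓝 g) := hg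
  exact tendsto_iff_forall_eval_tendsto_topDualPairing.1 hg' x

/-! ### Compact order intervals and order continuity -/

theorem WeakStarNullImpliesUnNull.tendsto_norm (H : WeakStarNullImpliesUnNull X) {l : Filter ℕ}
    [l.NeBot] {f : ℕ → StrongDual ℝ X} {g u : StrongDual ℝ X} (hu : 0 ≤ u)
    (hf : ∀ x, Tendsto (fun n => f n x) l (𝓝 (g x))) :
    Tendsto (fun n => ‖|f n - g| ⊓ u‖) l (𝓝 0) := by
  have := H l (fun n => f n - g) (fun x => by
    simpa using (hf x).sub_const (g x)) u hu
  simpa only [sub_zero] using this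

/-- The weak* limit `g` stays in `[0, u]`, so `|v n - g| ≤ u`: the meet with `u` has no effect, and
un-convergence is norm convergence. -/
theorem WeakStarNullImpliesUnNull.isCompact_Icc (H : WeakStarNullImpliesUnNull X)
    {u : StrongDual ℝ X} (hu : 0 ≤ u) : IsCompact (Set.Icc 0 u) := by
  refine IsSeqCompact.isCompact fun v hv => ?_
  obtain ⟨g, hg⟩ := exists_tendsto_apply_of_norm_le (hyperfilter ℕ) v
    (fun n => norm_le_norm_of_nonneg_of_le (hv n).1 (hv n).2)
  have hgu : g ∈ Set.Icc 0 u :=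
    ⟨fun x hx => ge_of_tendsto' (hg x) fun n => (hv n).1 x hx,
      fun x hx => le_of_tendsto' (hg x) fun n => (hv n).2 x hx⟩
  have h1 := H.tendsto_norm hu hg
  have h2 : Tendsto v (hyperfilter ℕ) (𝓝 g) := by
    rw [tendsto_iff_norm_sub_tendsto_zero]
    refine h1.congr fun n => ?_
    rw [inf_eq_left.2, norm_abs_eq_norm]
    exact abs_le'.2 ⟨(sub_le_self _ hgu.1).trans (hv n).2, by
      rw [neg_sub]; exact (sub_le_self _ (hv n).1).trans hgu.2⟩
  obtain ⟨ψ, hψ, hlim⟩ := MapClusterPt.tendsto_subseq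
    (h2.mapClusterPt.mono (by rw [← Nat.cofinite_eq_atTop]; exact hyperfilter_le_cofinite))
  exact ⟨g, hgu, ψ, hψ, hlim⟩

theorem WeakStarNullImpliesUnNull.isOrderContinuous_dual (H : WeakStarNullImpliesUnNull X) :
    IsOrderContinuous (StrongDual ℝ X) := by
  refine isOrderContinuous_of_antitone_seq fun f hf hf0 ε hε => ?_
  obtain ⟨g, -, ψ, hψ, hlim⟩ := (H.isCompact_Icc (hf0 0)).isSeqCompact
    (x := f) fun n => ⟨hf0 n, hf (Nat.zero_le n)⟩
  have h0 : Tendsto (fun n => ‖f (ψ n) - f (ψ (n + 1))‖) atTop (𝓝 0) := by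
    simpa using (hlim.sub (hlim.comp (tendsto_add_atTop_nat 1))).norm
  obtain ⟨n, hn⟩ := (h0.eventually (gt_mem_nhds hε)).exists
  refine ⟨ψ n, lt_of_le_of_lt ?_ hn⟩
  exact norm_le_norm_of_nonneg_of_le (sub_nonneg.2 (hf (Nat.le_succ _)))
    (sub_le_sub_left (hf (Nat.succ_le_of_lt (hψ (Nat.lt_succ_self n)))) _)

theorem exists_nonneg_dual_vector (x : X) (hx : 0 ≤ x) :
    ∃ f : StrongDual ℝ X, 0 ≤ f ∧ ‖f‖ ≤ 1 ∧ ‖x‖ ≤ f x := by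
  obtain ⟨g, hg, hgx⟩ := exists_dual_vector'' ℝ x
  refine ⟨|g|, abs_nonneg g, by rwa [norm_abs_eq_norm], ?_⟩
  calc ‖x‖ = g x := hgx.symm
    _ ≤ |g| x := dual_le_iff.1 (le_abs_self g) x hx

/-- Let `f n` norm the gap `x n - x (n + 1)` and let `g` be a weak* limit. The value of `g` on the
gaps tends to zero, and that of `f n - g` is at most `(f n - g)⁺ (x 0)`, which also tends to zero.
-/
theorem WeakStarNullImpliesUnNull.isOrderContinuous [CompleteSpace X]
    (H : WeakStarNullImpliesUnNull X) : IsOrderContinuous X := by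
  refine isOrderContinuous_of_antitone_seq fun x hx hx0 ε hε => ?_
  by_contra! hcon
  have hd : ∀ n, 0 ≤ x n - x (n + 1) := fun n => sub_nonneg.2 (hx (Nat.le_succ n))
  choose f hf0 hf1 hfd using fun n => exists_nonneg_dual_vector _ (hd n)
  obtain ⟨g, hg⟩ := exists_tendsto_apply_of_norm_le (hyperfilter ℕ) f hf1
  have hg0 : 0 ≤ g := fun y hy => ge_of_tendsto' (hg y) fun n => hf0 n y hy
  have hle : (hyperfilter ℕ : Filter ℕ) ≤ atTop := by
    rw [← Nat.cofinite_eq_atTop]; exact hyperfilter_le_cofinite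
  -- Since `f n ≥ 0`, the negative part is below both `g` and `|f n - g|`, where un-convergence
  -- applies.
  have hneg : Tendsto (fun n => (f n - g)⁻) (hyperfilter ℕ) (𝓝 0) := by
    rw [tendsto_zero_iff_norm_tendsto_zero]
    refine squeeze_zero (fun n => norm_nonneg _) (fun n => ?_) (H.tendsto_norm hg0 hg)
    refine norm_le_norm_of_nonneg_of_le (negPart_nonneg _) (le_inf ?_ ?_)
    · exact sup_le (neg_le_abs _) (abs_nonneg _)
    · refine sup_le ?_ hg0
      rw [neg_sub]
      exact sub_le_self g (hf0 n)
  have hneg0 : Tendsto (fun n => (f n - g)⁻ (x 0)) (hyperfilter ℕ) (𝓝 0) :=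
    ((ContinuousLinearMap.apply ℝ ℝ (x 0)).continuous.tendsto' 0 0 (by simp)).comp hneg
  have hpos0 : Tendsto (fun n => (f n - g)⁺ (x 0)) (hyperfilter ℕ) (𝓝 0) := by
    have h1 : Tendsto (fun n => (f n - g) (x 0)) (hyperfilter ℕ) (𝓝 0) := by
      simpa using (hg (x 0)).sub_const (g (x 0))
    have h2 := h1.add hneg0
    rw [add_zero] at h2
    refine h2.congr fun n => ?_
    have h3 := congrArg (fun φ : StrongDual ℝ X => φ (x 0)) (posPart_sub_negPart (f n - g))
    simp only [sub_apply] at h3 ⊢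
    linarith
  have hgd : Tendsto (fun n => g (x n - x (n + 1))) (hyperfilter ℕ) (𝓝 0) := by
    have h1 : Antitone fun n => g (x n) := fun m n hmn => dual_monotone hg0 (hx hmn)
    have h2 := tendsto_atTop_ciInf h1 ⟨0, by rintro _ ⟨n, rfl⟩; exact hg0 _ (hx0 n)⟩
    have h3 := h2.sub (h2.comp (tendsto_add_atTop_nat 1))
    rw [sub_self] at h3
    refine (h3.mono_left hle).congr fun n => ?_
    simp
  have hsum := hpos0.add hgd
  rw [add_zero] at hsum
  obtain ⟨n, hn⟩ := (hsum.eventually (gt_mem_nhds hε)).exists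
  have h1 : (f n - g)⁺ (x n - x (n + 1)) ≤ (f n - g)⁺ (x 0) :=
    dual_monotone (posPart_nonneg _) ((sub_le_self _ (hx0 _)).trans (hx (Nat.zero_le n)))
  have h2 : (f n - g) (x n - x (n + 1)) ≤ (f n - g)⁺ (x n - x (n + 1)) :=
    dual_le_iff.1 (le_posPart _) _ (hd n)
  have h3 := hfd n
  have h4 := hcon n
  rw [sub_apply] at h2
  linarith

/-! ### Atomicity of the dual -/

/-- Without atoms below `u`, finitely many linear conditions can be met by a component of `u`. -/
theorem exists_component_apply_eq_half {u : StrongDual ℝ X} (hu : 0 ≤ u)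
    (hcomp : IsCompact (Set.Icc 0 u))
    (hno : ∀ a ∈ principalIdealSubmodule u, ¬ IsAtomVector a) (F : Finset X) :
    ∃ v ∈ Set.Icc 0 u, v ⊓ (u - v) = 0 ∧ ∀ x ∈ F, v x = u x / 2 := by
  have hclosed : IsClosed {v : StrongDual ℝ X | ∀ x ∈ F, v x = u x / 2} := by
    simp only [Set.ofPred_forall]
    exact isClosed_biInter fun x _ =>
      isClosed_eq (ContinuousLinearMap.apply ℝ ℝ x).continuous continuous_const
  have hhalf : (2⁻¹ : ℝ) • u ∈ Set.Icc 0 u := by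
    refine ⟨smul_nonneg (by norm_num) hu, ?_⟩
    conv_rhs => rw [← one_smul ℝ u]
    exact smul_le_smul_of_nonneg_right (by norm_num) hu
  -- Krein–Milman; the set contains `u / 2`. If `w = v ⊓ (u - v)` were nonzero, its ideal would be
  -- infinite-dimensional and contain a nonzero `z` vanishing on `F`; a small multiple of `z`
  -- perturbs `v` both ways inside the set.
  obtain ⟨v, ⟨hvu, hvF⟩, hvext⟩ := (hcomp.inter_right hclosed).extremePoints_nonempty
    ⟨(2⁻¹ : ℝ) • u, hhalf, fun x _ => by simp [div_eq_inv_mul]⟩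
  refine ⟨v, hvu, ?_, hvF⟩
  by_contra hw
  set w := v ⊓ (u - v) with hwdef
  have hw0 : 0 ≤ w := le_inf hvu.1 (sub_nonneg.2 hvu.2)
  have hwu : w ∈ principalIdealSubmodule u := ⟨1, zero_le_one, by
    rw [one_smul, abs_of_nonneg hw0, abs_of_nonneg hu]; exact inf_le_left.trans hvu.2⟩
  have hinf : ¬ FiniteDimensional ℝ (principalIdealSubmodule w) := fun hfin => by
    obtain ⟨a, ha, ha'⟩ := exists_isAtomVector_of_finiteDimensional hw0 hw hfin
    exact hno a (principalIdealSubmodule_mono hwu ha) ha'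
  let T : principalIdealSubmodule w →ₗ[ℝ] (F → ℝ) :=
    LinearMap.pi fun x => (ContinuousLinearMap.apply ℝ ℝ (x : X)).toLinearMap ∘ₗ
      (principalIdealSubmodule w).subtype
  have hT : ¬ Function.Injective T := fun hinj => hinf (Module.Finite.of_injective T hinj)
  rw [← LinearMap.ker_eq_bot, Submodule.eq_bot_iff] at hT
  push Not at hT
  obtain ⟨⟨z, c, hc, hzw⟩, hzT, hz0⟩ := hT
  have hzF : ∀ x ∈ F, z x = 0 := fun x hx => congrFun (LinearMap.mem_ker.1 hzT) ⟨x, hx⟩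
  have hz0' : z ≠ 0 := fun h => hz0 (Subtype.ext h)
  rw [abs_of_nonneg hw0] at hzw
  have hc1 : 0 < c + 1 := by linarith
  set y := (c + 1)⁻¹ • z with hy
  have hyw : |y| ≤ w := by
    refine (abs_smul_le_smul_abs _ _).trans ?_
    rw [abs_of_pos (inv_pos.2 hc1), inv_smul_le_iff_of_pos hc1]
    exact hzw.trans (smul_le_smul_of_nonneg_right (by linarith) hw0)
  have hyF : ∀ x ∈ F, y x = 0 := fun x hx => by simp [hy, hzF x hx]
  have hy1 : y ≤ w := (le_abs_self y).trans hyw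
  have hy2 : -y ≤ w := (neg_le_abs y).trans hyw
  have hwv : w ≤ v := inf_le_left
  have hwuv : w ≤ u - v := inf_le_right
  have hplus : v + y ∈ Set.Icc 0 u ∩ {v | ∀ x ∈ F, v x = u x / 2} := by
    refine ⟨⟨?_, ?_⟩, fun x hx => by simp [hyF x hx, hvF x hx]⟩
    · rw [← neg_le_iff_add_nonneg]; exact hy2.trans hwv
    · rw [← le_sub_iff_add_le']; exact hy1.trans hwuv
  have hminus : v - y ∈ Set.Icc 0 u ∩ {v | ∀ x ∈ F, v x = u x / 2} := by
    refine ⟨⟨?_, ?_⟩, fun x hx => by simp [hyF x hx, hvF x hx]⟩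
    · rw [sub_nonneg]; exact hy1.trans hwv
    · rw [sub_eq_add_neg, ← le_sub_iff_add_le']; exact hy2.trans hwuv
  have := hvext hplus hminus ⟨2⁻¹, 2⁻¹, by norm_num, by norm_num, by norm_num, by module⟩
  have hy0 : y = 0 := by simpa using this
  exact hz0' ((smul_eq_zero.1 hy0).resolve_left (inv_pos.2 hc1).ne')

/-- Components form a closed subset of `[0, u]`, so the finite intersection property gives a
component equal to `u / 2`. It is disjoint from itself, hence zero. -/
theorem exists_isAtomVector_of_isCompact_Icc {u : StrongDual ℝ X} (hu : 0 ≤ u) (hu0 : u ≠ 0)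
    (hcomp : IsCompact (Set.Icc 0 u)) : ∃ a ∈ principalIdealSubmodule u, IsAtomVector a := by
  by_contra! hno
  have hC : IsCompact (Set.Icc 0 u ∩ {v | v ⊓ (u - v) = 0}) :=
    hcomp.inter_right (isClosed_eq (continuous_id.inf (continuous_const.sub continuous_id))
      continuous_const)
  obtain ⟨v, ⟨-, hv⟩, hv'⟩ := hC.inter_iInter_nonempty
    (fun x : X => {v : StrongDual ℝ X | v x = u x / 2})
    (fun x => isClosed_eq (ContinuousLinearMap.apply ℝ ℝ x).continuous continuous_const)
    (fun F => by
      obtain ⟨v, h1, h2, h3⟩ := exists_component_apply_eq_half hu hcomp hno F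
      exact ⟨v, ⟨h1, h2⟩, Set.mem_iInter₂.2 h3⟩)
  rw [Set.mem_iInter] at hv'
  have hvu : v = (2⁻¹ : ℝ) • u := by
    ext x
    have := hv' x
    simpa [div_eq_inv_mul] using this
  have huv : u - v = v := by rw [hvu]; module
  have hv0 : v = 0 := by
    have h : v ⊓ (u - v) = 0 := hv
    rwa [huv, inf_idem] at h
  refine hu0 ?_
  rw [← sub_add_cancel u v, huv, hv0, add_zero]

theorem WeakStarNullImpliesUnNull.isAtomicLattice_dual (H : WeakStarNullImpliesUnNull X) :
    IsAtomicLattice (StrongDual ℝ X) := by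
  refine sInf_eq_top.2 ?_
  rintro B ⟨⟨hsolid, hsup⟩, hatoms⟩
  have key : ∀ u : StrongDual ℝ X, 0 ≤ u → u ∈ B := fun u hu => by
    -- `u - s` is the largest part of `u` lying in `B`. An atom below a nonzero remainder `s` could
    -- be subtracted too, contradicting minimality.
    obtain ⟨s, hs, -⟩ := H.isOrderContinuous_dual.exists_isGLB_mem_closure
      (S := {w | w ∈ Set.Icc 0 u ∧ u - w ∈ B}) ⟨u, ⟨hu, le_rfl⟩, by simp⟩
      (fun w hw z hz => by
        refine ⟨w ⊓ z, ⟨⟨le_inf hw.1.1 hz.1.1, inf_le_left.trans hw.1.2⟩, ?_⟩,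
          inf_le_left, inf_le_right⟩
        refine hsolid _ ((u - w) + (u - z)) ?_ (B.add_mem hw.2 hz.2)
        have h1 : 0 ≤ u - w := sub_nonneg.2 hw.1.2
        have h2 : 0 ≤ u - z := sub_nonneg.2 hz.1.2
        rw [abs_of_nonneg (sub_nonneg.2 (inf_le_left.trans hw.1.2)),
          abs_of_nonneg (add_nonneg h1 h2), sub_le_comm]
        refine le_inf ?_ ?_
        · rw [sub_le_comm]; exact le_add_of_nonneg_right h2
        · rw [sub_le_comm]; exact le_add_of_nonneg_left h1)
      ⟨0, fun w hw => hw.1.1⟩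
    have hs0 : 0 ≤ s := hs.2 fun w hw => hw.1.1
    have hsu : s ≤ u := hs.1 ⟨⟨hu, le_rfl⟩, by simp⟩
    have husB : u - s ∈ B := by
      refine hsup {v | v ∈ Set.Icc 0 u ∧ v ∈ B} (u - s) (fun v hv => hv.2) ⟨fun v hv => ?_,
        fun b hb => ?_⟩
      · rw [le_sub_comm]
        exact hs.1 ⟨⟨sub_nonneg.2 hv.1.2, sub_le_self _ hv.1.1⟩, by rw [sub_sub_cancel]; exact hv.2⟩
      · rw [sub_le_comm]
        refine hs.2 fun w hw => ?_
        rw [sub_le_comm]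
        exact hb ⟨⟨sub_nonneg.2 hw.1.2, sub_le_self _ hw.1.1⟩, hw.2⟩
    by_cases hne : s = 0
    · simpa [hne] using husB
    obtain ⟨a, ⟨c, hc, hac⟩, ha⟩ := exists_isAtomVector_of_isCompact_Icc hs0 hne
      (H.isCompact_Icc hs0)
    rw [abs_of_nonneg hs0, abs_of_nonneg ha.1] at hac
    have hc1 : 0 < c + 1 := by linarith
    have h1 : (c + 1)⁻¹ • a ≤ s := by
      rw [inv_smul_le_iff_of_pos hc1]
      exact hac.trans (smul_le_smul_of_nonneg_right (by linarith) hs0)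
    have h2 : 0 ≤ (c + 1)⁻¹ • a := smul_nonneg (inv_pos.2 hc1).le ha.1
    have h3 : s ≤ s - (c + 1)⁻¹ • a := hs.1 ⟨⟨sub_nonneg.2 h1, (sub_le_self _ h2).trans hsu⟩, by
      rw [← sub_add]
      exact B.add_mem husB (B.smul_mem _ (hatoms ha))⟩
    have h4 : (c + 1)⁻¹ • a = 0 := le_antisymm (by simpa using h3) h2
    exact absurd ((smul_eq_zero.1 h4).resolve_left (inv_pos.2 hc1).ne') ha.2.1
  refine eq_top_iff.2 fun f _ => ?_
  rw [← posPart_sub_negPart f]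
  exact B.sub_mem (key _ (posPart_nonneg f)) (key _ (negPart_nonneg f))

end WeakStarNull

/-! ### Disjoint complements as bands -/

section DisjointComplement

set_option linter.unusedSectionVars false

variable {E : Type*} [NormedAddCommGroup E] [NormedSpace ℝ E] [Lattice E] [HasSolidNorm E]
  [IsOrderedAddMonoid E] [IsOrderedModule ℝ E]

theorem add_inf_le_inf_add_inf {x y w : E} (hx : 0 ≤ x) (hy : 0 ≤ y) (hw : 0 ≤ w) :
    (x + y) ⊓ w ≤ x ⊓ w + y ⊓ w := by
  rw [add_inf, inf_add, inf_add]
  exact le_inf (le_inf inf_le_left (inf_le_right.trans (le_add_of_nonneg_right hy)))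
    (le_inf (inf_le_right.trans (le_add_of_nonneg_left hx))
      (inf_le_right.trans (le_add_of_nonneg_left hw)))

/-- The vectors disjoint from a positive vector. -/
def disjointComplement (w : E) (hw : 0 ≤ w) : Submodule ℝ E where
  carrier := {x | |x| ⊓ w = 0}
  zero_mem' := by simpa using hw
  add_mem' := by
    intro x y hx hy
    refine le_antisymm ?_ (le_inf (abs_nonneg _) hw)
    calc |x + y| ⊓ w ≤ (|x| + |y|) ⊓ w := inf_le_inf_right _ (abs_add_le x y)
      _ ≤ |x| ⊓ w + |y| ⊓ w := add_inf_le_inf_add_inf (abs_nonneg x) (abs_nonneg y) hw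
      _ = 0 := by rw [hx, hy, add_zero]
  smul_mem' := by
    intro c x hx
    refine le_antisymm ?_ (le_inf (abs_nonneg _) hw)
    have hc : 0 < |c| + 1 := by positivity
    have h1 : (|c| + 1)⁻¹ • (|c • x| ⊓ w) ≤ |x| := by
      rw [inv_smul_le_iff_of_pos hc]
      exact inf_le_left.trans ((abs_smul_le_smul_abs c x).trans
        (smul_le_smul_of_nonneg_right (by linarith) (abs_nonneg x)))
    have h2 : (|c| + 1)⁻¹ • (|c • x| ⊓ w) ≤ w := by
      rw [inv_smul_le_iff_of_pos hc]
      refine inf_le_right.trans ?_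
      conv_lhs => rw [← one_smul ℝ w]
      exact smul_le_smul_of_nonneg_right (by linarith [abs_nonneg c]) hw
    have h3 := (le_inf h1 h2).trans hx.le
    rwa [inv_smul_le_iff_of_pos hc, smul_zero] at h3

theorem mem_disjointComplement {w : E} {hw : 0 ≤ w} {x : E} :
    x ∈ disjointComplement w hw ↔ |x| ⊓ w = 0 := Iff.rfl

theorem disjointComplement_solid {w : E} {hw : 0 ≤ w} {x y : E} (hxy : |x| ≤ |y|)
    (hy : y ∈ disjointComplement w hw) : x ∈ disjointComplement w hw :=
  le_antisymm ((inf_le_inf_right _ hxy).trans hy.le) (le_inf (abs_nonneg _) hw)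

theorem isBand_disjointComplement (w : E) (hw : 0 ≤ w) : IsBand (disjointComplement w hw) := by
  refine ⟨fun x y hxy hy => disjointComplement_solid hxy hy, fun S x hS hx => ?_⟩
  rcases S.eq_empty_or_nonempty with rfl | ⟨s₀, hs₀⟩
  · have h : x ≤ x - w := hx.2 (by simp)
    have hw0 : w = 0 := le_antisymm (by simpa using h) hw
    rw [mem_disjointComplement, hw0]
    exact inf_eq_right.2 (abs_nonneg x)
  have habs : ∀ s : E, s⁺ ≤ |s| ∧ s⁻ ≤ |s| := fun s =>
    ⟨sup_le (le_abs_self s) (abs_nonneg s), sup_le (neg_le_abs s) (abs_nonneg s)⟩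
  have hneg : x⁻ ∈ disjointComplement w hw := by
    refine disjointComplement_solid ?_ (hS hs₀)
    rw [abs_of_nonneg (negPart_nonneg x)]
    exact (sup_le_sup_right (neg_le_neg (hx.1 hs₀)) 0).trans (habs s₀).2
  have hpos : x⁺ ∈ disjointComplement w hw := by
    rw [mem_disjointComplement, abs_of_nonneg (posPart_nonneg x)]
    set d := x⁺ ⊓ w with hd
    have hd0 : 0 ≤ d := le_inf (posPart_nonneg x) hw
    -- Each `s` in `S` is disjoint from `d ≤ x⁺`, so `x - d` is still an upper bound; hence `d = 0`.
    have hub : x ≤ x - d := hx.2 fun s hs => by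
      have h1 : s⁺ ⊓ d = 0 := le_antisymm
        ((inf_le_inf (habs s).1 inf_le_right).trans (hS hs).le) (le_inf (posPart_nonneg s) hd0)
      have h2 : s⁺ + d ≤ x⁺ := by
        rw [← inf_add_sup s⁺ d, h1, zero_add]
        exact sup_le (sup_le_sup_right (hx.1 hs) 0) inf_le_left
      have h3 : x⁻ ≤ s⁻ := sup_le_sup_right (neg_le_neg (hx.1 hs)) 0
      rw [le_sub_iff_add_le]
      calc s + d = (s⁺ + d) - s⁻ := by
            conv_lhs => rw [← posPart_sub_negPart s]
            abel
        _ ≤ x⁺ - x⁻ := sub_le_sub h2 h3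
        _ = x := posPart_sub_negPart x
    exact le_antisymm (by simpa using hub) hd0
  rw [← posPart_sub_negPart x]
  exact Submodule.sub_mem _ hpos hneg

/-- In an atomic lattice, a positive vector disjoint from all atoms vanishes. -/
theorem IsAtomicLattice.eq_zero_of_inf_atom_eq_zero (hE : IsAtomicLattice E) {w : E} (hw : 0 ≤ w)
    (h : ∀ a, IsAtomVector a → a ⊓ w = 0) : w = 0 := by
  have htop := sInf_eq_top.1 hE (disjointComplement w hw) ⟨isBand_disjointComplement w hw,
    fun a ha => by
      change |a| ⊓ w = 0
      rw [abs_of_nonneg ha.1]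
      exact h a ha⟩
  have hmem : w ∈ disjointComplement w hw := htop ▸ Submodule.mem_top
  rwa [mem_disjointComplement, abs_of_nonneg hw, inf_idem] at hmem

theorem IsAtomVector.exists_eq_smul {a x : E} (ha : IsAtomVector a) (hx : 0 ≤ x) (hxa : x ≤ a) :
    ∃ c : ℝ, x = c • a := by
  have h : x ∈ principalIdeal a :=
    ⟨1, zero_le_one, by rwa [one_smul, abs_of_nonneg hx, abs_of_nonneg ha.1]⟩
  rw [ha.2.2] at h
  obtain ⟨c, hc⟩ := Submodule.mem_span_singleton.1 h
  exact ⟨c, hc.symm⟩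

theorem IsAtomVector.smul {a : E} (ha : IsAtomVector a) {c : ℝ} (hc : 0 < c) :
    IsAtomVector (c • a) := by
  have hca : 0 ≤ c • a := smul_nonneg hc.le ha.1
  refine ⟨hca, smul_ne_zero hc.ne' ha.2.1, ?_⟩
  rw [Submodule.span_singleton_smul_eq (IsUnit.mk0 c hc.ne'), ← ha.2.2]
  ext x
  constructor
  · rintro ⟨r, hr, hx⟩
    refine ⟨r * c, mul_nonneg hr hc.le, ?_⟩
    rwa [abs_of_nonneg hca, smul_smul, ← abs_of_nonneg ha.1] at hx
  · rintro ⟨r, hr, hx⟩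
    refine ⟨r * c⁻¹, mul_nonneg hr (inv_pos.2 hc).le, ?_⟩
    rwa [abs_of_nonneg hca, smul_smul, mul_assoc, inv_mul_cancel₀ hc.ne', mul_one,
      ← abs_of_nonneg ha.1]

end DisjointComplement

/-! ### Carrier atoms, coordinate projections and the converse -/

section AtomicDual

set_option linter.unusedSectionVars false

variable {X : Type u} [NormedAddCommGroup X] [NormedSpace ℝ X] [Lattice X] [HasSolidNorm X]
  [IsOrderedAddMonoid X] [IsOrderedModule ℝ X]

/-- Hahn–Banach gives `0 ≤ g ≤ a` with `g (p - q) = a p`. As `g = c • a`, positivity forces `c * a q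
= 0`. -/
theorem IsAtomVector.apply_eq_zero_or {a : StrongDual ℝ X} (ha : IsAtomVector a) {p q : X}
    (hp : 0 ≤ p) (hq : 0 ≤ q) (hpq : p ⊓ q = 0) : a p = 0 ∨ a q = 0 := by
  obtain ⟨g, hg0, hga, hg⟩ := exists_le_apply_eq_apply_posPart ha.1 (p - q)
  have hpos : (p - q)⁺ = p := by
    rw [inf_eq_sub_posPart_sub, sub_eq_zero] at hpq
    exact hpq.symm
  rw [hpos, map_sub] at hg
  obtain ⟨c, rfl⟩ := ha.exists_eq_smul hg0 hga
  have h1 := hga p hp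
  have h2 := hg0 q hq
  simp only [smul_apply, zero_apply, smul_eq_mul] at hg h1 h2
  have h3 : c * a q = 0 := by linarith
  rcases mul_eq_zero.1 h3 with hc | hc
  · left
    simpa [hc] using hg.symm
  · exact Or.inr hc

theorem IsAtomVector.apply_inf_eq {a : StrongDual ℝ X} (ha : IsAtomVector a) {y z : X}
    (h : a y ≤ a z) : a (y ⊓ z) = a y := by
  have h1 : (y - y ⊓ z) ⊓ (z - y ⊓ z) = 0 := by rw [← inf_sub, sub_self]
  have h2 := dual_monotone ha.1 (inf_le_left : y ⊓ z ≤ y)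
  rcases ha.apply_eq_zero_or (sub_nonneg.2 inf_le_left) (sub_nonneg.2 inf_le_right) h1 with h3 | h3
  all_goals rw [map_sub] at h3; linarith

/-- `e` is an atom of `X` at which the atom `a` of the dual is normalized. -/
def IsCarrierAtom (a : StrongDual ℝ X) (e : X) : Prop :=
  0 ≤ e ∧ a e = 1 ∧ ∀ y, 0 ≤ y → y ≤ e → y = a y • e

/-- `a` preserves meets, so the `y` in `[0, x]` with `a y = 1` form a downward directed closed set.
Order continuity puts its infimum `e` in the set, and minimality of `e` makes it an atom. -/
theorem IsAtomVector.exists_isCarrierAtom [CompleteSpace X] (hX : IsOrderContinuous X)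
    {a : StrongDual ℝ X} (ha : IsAtomVector a) : ∃ e, IsCarrierAtom a e := by
  obtain ⟨x, hx, hax⟩ : ∃ x, 0 ≤ x ∧ a x = 1 := by
    obtain ⟨z, hz, haz⟩ : ∃ z, 0 ≤ z ∧ a z ≠ 0 := by
      by_contra! hcon
      exact ha.2.1 (le_antisymm (fun z hz => (hcon z hz).le) ha.1)
    exact ⟨(a z)⁻¹ • z, smul_nonneg (inv_nonneg.2 (ha.1 z hz)) hz, by simp [haz]⟩
  obtain ⟨e, he, hecl⟩ := hX.exists_isGLB_mem_closure (S := Set.Icc 0 x ∩ {y | a y = 1})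
    ⟨x, ⟨hx, le_rfl⟩, hax⟩
    (fun y hy z hz => ⟨y ⊓ z, ⟨⟨le_inf hy.1.1 hz.1.1, inf_le_left.trans hy.1.2⟩,
      (ha.apply_inf_eq (hy.2.trans hz.2.symm).le).trans hy.2⟩, inf_le_left, inf_le_right⟩)
    ⟨0, fun y hy => hy.1.1⟩
  have hclosed : IsClosed (Set.Icc 0 x ∩ {y | a y = 1}) :=
    isClosed_Icc.inter (isClosed_eq a.continuous continuous_const)
  rw [hclosed.closure_eq] at hecl
  obtain ⟨⟨he0, hex⟩, hae⟩ := hecl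
  have hae : a e = 1 := hae
  have key : ∀ y, 0 ≤ y → y ≤ e → a y • e ≤ y := fun y hy hye => by
    rcases (ha.1 y hy).eq_or_lt with h | h
    · have h : a y = 0 := h.symm
      rw [h, zero_smul]
      exact hy
    · have h : 0 < a y := h
      have h1 : 0 ≤ (a y)⁻¹ • y := smul_nonneg (inv_pos.2 h).le hy
      have h2 : a ((a y)⁻¹ • y) = 1 := by simp [h.ne']
      have h3 : e ≤ (a y)⁻¹ • y ⊓ e := he.1 ⟨⟨le_inf h1 he0, inf_le_right.trans hex⟩,
        (ha.apply_inf_eq (h2.trans hae.symm).le).trans h2⟩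
      exact (le_inv_smul_iff_of_pos h).1 (h3.trans inf_le_left)
  refine ⟨e, he0, hae, fun y hy hye => le_antisymm ?_ (key y hy hye)⟩
  -- The reverse inequality is the same bound for the complement `e - y`.
  have h := key (e - y) (sub_nonneg.2 hye) (sub_le_self _ hy)
  rw [map_sub, hae, sub_smul, one_smul] at h
  exact (sub_le_sub_iff_left e).1 h

theorem IsCarrierAtom.apply_smul_le {a : StrongDual ℝ X} {e : X} (he : IsCarrierAtom a e)
    (ha : IsAtomVector a) {x : X} (hx : 0 ≤ x) : a x • e ≤ x := by
  have hax : 0 ≤ a x := ha.1 x hx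
  have hr : 0 < a x + 1 := by linarith
  have h0 : 0 ≤ (a x + 1)⁻¹ • x := smul_nonneg (inv_pos.2 hr).le hx
  have h1 : a ((a x + 1)⁻¹ • x) ≤ a e := by
    rw [he.2.1, map_smul, smul_eq_mul, inv_mul_le_iff₀ hr]
    linarith
  have h2 := he.2.2 ((a x + 1)⁻¹ • x ⊓ e) (le_inf h0 he.1) inf_le_right
  rw [ha.apply_inf_eq h1, map_smul, smul_eq_mul, mul_smul] at h2
  have h3 : (a x + 1)⁻¹ • a x • e ≤ (a x + 1)⁻¹ • x := h2 ▸ inf_le_left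
  rwa [inv_smul_le_iff_of_pos hr, smul_inv_smul₀ hr.ne'] at h3

theorem IsCarrierAtom.dual_apply_smul_le {a : StrongDual ℝ X} {e : X} (he : IsCarrierAtom a e)
    (ha : IsAtomVector a) {f : StrongDual ℝ X} (hf : 0 ≤ f) : f e • a ≤ f := fun x hx => by
  have h := dual_monotone hf (he.apply_smul_le ha hx)
  rw [map_smul, smul_eq_mul] at h
  rw [smul_apply, smul_eq_mul, mul_comm]
  exact h

theorem IsCarrierAtom.abs_apply {a : StrongDual ℝ X} {e : X} (he : IsCarrierAtom a e)
    (ha : IsAtomVector a) (f : StrongDual ℝ X) : |f| e = |f e| := by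
  refine le_antisymm (dual_abs_apply_le f he.1 fun y hy => ?_) ?_
  · have h1 := he.2.2 y⁺ (posPart_nonneg y)
      ((sup_le (le_abs_self y) (abs_nonneg y)).trans hy)
    have h2 := he.2.2 y⁻ (negPart_nonneg y)
      ((sup_le (neg_le_abs y) (abs_nonneg y)).trans hy)
    have h3 : y = a y • e := by
      conv_lhs => rw [← posPart_sub_negPart y, h1, h2, ← sub_smul, ← map_sub, posPart_sub_negPart]
    have h4 : |a y| ≤ 1 := by
      have h5 := abs_apply_le_abs_apply_abs a y
      rw [abs_of_nonneg ha.1] at h5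
      exact h5.trans ((dual_monotone ha.1 hy).trans he.2.1.le)
    rw [h3, map_smul, smul_eq_mul]
    refine (le_abs_self _).trans ?_
    rw [abs_mul]
    exact mul_le_of_le_one_left (abs_nonneg _) h4
  · have h := abs_apply_le_abs_apply_abs f e
    rwa [abs_of_nonneg he.1] at h

/-- `b e • a` lies below the atom `b`, hence is a multiple of it; evaluation at `e` shows that the
factor is one. -/
theorem IsCarrierAtom.eq_smul {a b : StrongDual ℝ X} {e : X} (he : IsCarrierAtom a e)
    (ha : IsAtomVector a) (hb : IsAtomVector b) (hbe : b e ≠ 0) : b = b e • a := by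
  obtain ⟨r, hr⟩ := hb.exists_eq_smul (smul_nonneg (hb.1 e he.1) ha.1)
    (he.dual_apply_smul_le ha hb.1)
  have h1 := congrArg (fun φ : StrongDual ℝ X => φ e) hr
  simp only [smul_apply, smul_eq_mul, he.2.1, mul_one] at h1
  have h2 : r = 1 := by
    have : (r - 1) * b e = 0 := by linarith
    linarith [(mul_eq_zero.1 this).resolve_right hbe]
  rw [hr, h2, one_smul]

variable (X) in
/-- The atoms of the dual of norm one. -/
def unitAtoms : Set (StrongDual ℝ X) := {a | IsAtomVector a ∧ ‖a‖ = 1}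

theorem IsCarrierAtom.apply_eq_zero_of_ne {a b : StrongDual ℝ X} {e : X} (he : IsCarrierAtom a e)
    (ha : a ∈ unitAtoms X) (hb : b ∈ unitAtoms X) (hab : b ≠ a) : b e = 0 := by
  by_contra hbe
  have h := he.eq_smul ha.1 hb.1 hbe
  have h1 : ‖b‖ = |b e| := by
    conv_lhs => rw [h, norm_smul, ha.2, mul_one, Real.norm_eq_abs]
  have h2 : b e = 1 := by
    have h3 : 0 ≤ b e := hb.1.1 e he.1
    rw [hb.2, abs_of_nonneg h3] at h1
    exact h1.symm
  rw [h2, one_smul] at h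
  exact hab h

/-- The projection of a functional onto the span of finitely many unit atoms. -/
def atomProj (e : unitAtoms X → X) (F : Finset (unitAtoms X)) (f : StrongDual ℝ X) :
    StrongDual ℝ X := ∑ a ∈ F, f (e a) • (a : StrongDual ℝ X)

section atomProj

variable {e : unitAtoms X → X}

theorem atomProj_sub (F : Finset (unitAtoms X)) (f g : StrongDual ℝ X) :
    atomProj e F (f - g) = atomProj e F f - atomProj e F g := by
  rw [atomProj, atomProj, atomProj, ← Finset.sum_sub_distrib]
  exact Finset.sum_congr rfl fun a _ => by
    ext x
    simp [sub_mul]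

theorem atomProj_nonneg (he : ∀ a : unitAtoms X, IsCarrierAtom a.1 (e a))
    (F : Finset (unitAtoms X)) {f : StrongDual ℝ X} (hf : 0 ≤ f) : 0 ≤ atomProj e F f :=
  Finset.sum_nonneg fun a _ => smul_nonneg (hf _ (he a).1) a.2.1.1

/-- Coordinates are subtracted one at a time: distinct unit atoms vanish at each other's carriers,
so the remainder keeps its next coordinate. -/
theorem atomProj_le (he : ∀ a : unitAtoms X, IsCarrierAtom a.1 (e a))
    (F : Finset (unitAtoms X)) {f : StrongDual ℝ X} (hf : 0 ≤ f) : atomProj e F f ≤ f := by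
  classical
  induction F using Finset.induction_on with
  | empty => simpa [atomProj] using hf
  | insert a F haF ih =>
    have h1 := (he a).dual_apply_smul_le a.2.1 (sub_nonneg.2 ih)
    have h2 : atomProj e F f (e a) = 0 := by
      rw [atomProj, sum_apply]
      refine Finset.sum_eq_zero fun b hb => ?_
      have hba : (b : StrongDual ℝ X) ≠ a := fun h => haF (Subtype.ext h ▸ hb)
      rw [smul_apply, (he a).apply_eq_zero_of_ne a.2 b.2 hba, smul_zero]
    rw [sub_apply, h2, sub_zero, le_sub_iff_add_le] at h1
    rwa [atomProj, Finset.sum_insert haF]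

theorem tendsto_norm_sub_atomProj (he : ∀ a : unitAtoms X, IsCarrierAtom a.1 (e a))
    (hat : IsAtomicLattice (StrongDual ℝ X)) (hoc : IsOrderContinuous (StrongDual ℝ X))
    {f : StrongDual ℝ X} (hf : 0 ≤ f) :
    Tendsto (fun F => ‖f - atomProj e F f‖) atTop (𝓝 0) := by
  classical
  refine hoc _ _ (fun F G hFG => sub_le_sub_left (Finset.sum_le_sum_of_subset_of_nonneg hFG
    fun a _ _ => smul_nonneg (hf _ (he a).1) a.2.1.1) _) ⟨?_, fun v hv => ?_⟩
  · rintro _ ⟨F, rfl⟩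
    exact sub_nonneg.2 (atomProj_le he F hf)
  -- Subtracting the single coordinate at `a` already makes the remainder vanish at `e a`.
  have hv' : ∀ a, v⁺ (e a) = 0 := fun a => by
    have h1 : v⁺ ≤ f - atomProj e {a} f :=
      sup_le (hv ⟨{a}, rfl⟩) (sub_nonneg.2 (atomProj_le he {a} hf))
    have h2 := h1 (e a) (he a).1
    rw [sub_apply, atomProj, Finset.sum_singleton, smul_apply, (he a).2.1, smul_eq_mul, mul_one,
      sub_self] at h2
    exact le_antisymm h2 (posPart_nonneg v _ (he a).1)
  have h0 := hat.eq_zero_of_inf_atom_eq_zero (posPart_nonneg v) fun a ha => by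
    have hna : 0 < ‖a‖ := norm_pos_iff.2 ha.2.1
    let b : unitAtoms X := ⟨‖a‖⁻¹ • a, ha.smul (inv_pos.2 hna), by
      rw [norm_smul, norm_inv, norm_norm, inv_mul_cancel₀ hna.ne']⟩
    obtain ⟨c, hc⟩ := ha.exists_eq_smul (le_inf ha.1 (posPart_nonneg v)) inf_le_left
    have h1 : (a ⊓ v⁺) (e b) ≤ 0 :=
      (hv' b) ▸ dual_le_iff.1 (inf_le_right : a ⊓ v⁺ ≤ v⁺) (e b) (he b).1
    have h2 : ‖a‖⁻¹ * a (e b) = 1 := (he b).2.1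
    have h3 : a (e b) = ‖a‖ := by
      field_simp at h2
      exact h2
    have h4 : c ≤ 0 := by
      rw [hc, smul_apply, h3, smul_eq_mul] at h1
      exact nonpos_of_mul_nonpos_left h1 hna
    refine le_antisymm ?_ (le_inf ha.1 (posPart_nonneg v))
    rw [hc]
    exact smul_nonpos_of_nonpos_of_nonneg h4 ha.1
  exact (le_posPart v).trans h0.le

theorem unTendsto_zero_of_isAtomicLattice_dual [CompleteSpace X]
    (hat : IsAtomicLattice (StrongDual ℝ X)) (hX : IsOrderContinuous X)
    (hoc : IsOrderContinuous (StrongDual ℝ X)) {ι : Type*} {l : Filter ι}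
    {f : ι → StrongDual ℝ X} (hf : ∀ x, Tendsto (fun i => f i x) l (𝓝 0)) : UnTendsto f l 0 := by
  intro u hu
  choose e he using fun a : unitAtoms X => a.2.1.exists_isCarrierAtom hX
  rw [← tendsto_zero_iff_norm_tendsto_zero, Metric.tendsto_nhds]
  intro ε hε
  obtain ⟨F, hF⟩ := ((tendsto_norm_sub_atomProj he hat hoc hu).eventually
    (gt_mem_nhds (half_pos hε))).exists
  have hlim : Tendsto (fun i => ‖atomProj e F |f i|‖) l (𝓝 0) := by
    rw [← tendsto_zero_iff_norm_tendsto_zero]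
    have : Tendsto (fun i => ∑ a ∈ F, |f i (e a)| • (a : StrongDual ℝ X)) l
        (𝓝 (∑ a ∈ F, |(0 : ℝ)| • (a : StrongDual ℝ X))) :=
      tendsto_finsetSum _ fun a _ => (hf (e a)).abs.smul_const _
    simp only [abs_zero, zero_smul, Finset.sum_const_zero] at this
    refine this.congr fun i => Finset.sum_congr rfl fun a _ => ?_
    rw [(he a).abs_apply a.2.1]
  filter_upwards [hlim.eventually (gt_mem_nhds (half_pos hε))] with i hi
  rw [dist_zero_right, sub_zero]
  have hw0 : 0 ≤ |f i| ⊓ u := le_inf (abs_nonneg _) hu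
  have h1 : atomProj e F (|f i| ⊓ u) ≤ atomProj e F |f i| := by
    rw [← sub_nonneg, ← atomProj_sub]
    exact atomProj_nonneg he F (sub_nonneg.2 inf_le_left)
  -- Positivity of `1 - P_F`, applied to `u - |f i| ⊓ u`.
  have h2 : |f i| ⊓ u - atomProj e F (|f i| ⊓ u) ≤ u - atomProj e F u := by
    have h := atomProj_le he F (sub_nonneg.2 (inf_le_right : |f i| ⊓ u ≤ u))
    rw [atomProj_sub] at h
    rw [← sub_nonneg] at h ⊢
    convert h using 1
    abel
  have h3 : |f i| ⊓ u ≤ atomProj e F |f i| + (u - atomProj e F u) := by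
    have h := add_le_add h1 h2
    rwa [add_sub_cancel] at h
  calc ‖|f i| ⊓ u‖ ≤ ‖atomProj e F |f i| + (u - atomProj e F u)‖ :=
        norm_le_norm_of_nonneg_of_le hw0 h3
    _ ≤ ‖atomProj e F |f i|‖ + ‖u - atomProj e F u‖ := norm_add_le _ _
    _ < ε := by linarith

end atomProj

end AtomicDual

end BanachLattice

theorem mainTheorem9 {X : Type*} [NormedAddCommGroup X] [NormedSpace ℝ X] [CompleteSpace X]
    [Lattice X] [HasSolidNorm X] [IsOrderedAddMonoid X] [IsOrderedModule ℝ X] :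
    (∀ (ι : Type*) [Preorder ι] [IsDirectedOrder ι] [Nonempty ι] (f : ι → StrongDual ℝ X),
        Tendsto (fun i => StrongDual.toWeakDual (f i)) atTop (𝓝 0) →
        BanachLattice.UnTendsto f atTop 0) ↔
      BanachLattice.IsAtomicLattice (StrongDual ℝ X) ∧
        BanachLattice.IsOrderContinuous X ∧
        BanachLattice.IsOrderContinuous (StrongDual ℝ X) := by
  constructor
  · intro h
    have H := BanachLattice.weakStarNullImpliesUnNull_of_nets h
    exact ⟨H.isAtomicLattice_dual, H.isOrderContinuous, H.isOrderContinuous_dual⟩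
  · rintro ⟨hat, hX, hoc⟩ ι _ _ _ f hf
    exact BanachLattice.unTendsto_zero_of_isAtomicLattice_dual hat hX hoc
      (BanachLattice.tendsto_toWeakDual_zero_iff.1 hf)
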